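/- Let $F$ be a local field (a non-discrete locally compact Hausdorff topological field) with $\mathrm{char}(F)\neq 2$, let $(V,q)$ be a finite-dimensional $F$-vector space with a non-degenerate symmetric bilinear form, and let $$V=\bigoplus_{i=1}^r(\ell_i\oplus\ell_i^*)\oplus V^\flat,\qquad r\ge 0,$$ be an orthogonal decomposition with $\ell_i\oplus\ell_i^*$ and $V^\flat$ non-degenerate, $V^\flat\neq 0$, and $\ell_i,\ell_i^*$ totally isotropic with $d_i:=\dim\ell_i=\dim\ell_i^*\ge 1$. Let $M^+(F)=\prod_{i=1}^r \mathrm{GL}_{d_i}(F)\times \mathrm{O}(V^\flat)(F)$ be the corresponding Levi subgroup of $\mathrm{O}(V)(F)$ (the stabilizer of all $\ell_i$, $\ell_i^*$ and $V^\flat$; here $\mathrm{GL}_{d_i}(F)$ is identified with $\mathrm{GL}(\ell_i)$ by a chosen basis of $\ell_i$ and acts on $\ell_i^*$ by the contragredient), and let $M(F)=\prod_{i=1}^r \mathrm{GL}_{d_i}(F)\times \mathrm{SO}(V^\flat)(F)=M^+(F)\cap\mathrm{SO}(V)(F)$ be the group of $F$-points of the identity component of $M^+$. Let $m\ge 1$,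 let $\boldsymbol\mu_m$ be the group of $m$-th roots of unity in $\mathbb{C}$, and let $$1\to\boldsymbol\mu_m\to\widetilde{G^+}\to \mathrm{O}(V)(F)\to 1$$ be a topological central extension. Let $\widetilde{M^+}$ and $\tilde M$ be the preimages of $M^+(F)$ and $M(F)$ in $\widetilde{G^+}$. Call $\widetilde{M^+}$ (resp. $\tilde M$) decomposed if it is isomorphic, as a topological central extension of $M^+(F)$ (resp. $M(F)$) by $\boldsymbol\mu_m$, to the external Baer sum of the preimages of the factors $\mathrm{GL}_{d_1}(F),\dots,\mathrm{GL}_{d_r}(F)$ and $\mathrm{O}(V^\flat)(F)$ (resp. $\mathrm{SO}(V^\flat)(F)$), that is, to the push-out of the product of these preimages along the multiplication map $\boldsymbol\mu_m^{r+1}\to\boldsymbol\mu_m$. For commuting $h_1,h_2\in\mathrm{O}(V)(F)$ put $\mathrm{comm}(h_1,h_2):=\tilde h_1\tilde h_2\tilde h_1^{-1}\tilde h_2^{-1}\in\boldsymbol\mu_m$, where $\tilde h_j$ is any preimage of $h_j$ in $\widetilde{G^+}$. Let $\tau\in \mathrm{O}(V^\flat)(F)\smallsetminus \mathrm{SO}(V^\flat)(F)$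 be arbitrary, viewed as an element of $M^+(F)$. Then $\widetilde{M^+}$ is decomposed if and only if (i) $\tilde M$ is decomposed, and (ii) $\mathrm{comm}(t,\tau)=1$ for all $1\le i\le r$ and all $t$ in the diagonal torus of $\mathrm{GL}_{d_i}(F)$. -/

import Mathlib

/-- A topological central extension `1 → A → E → H → 1`: the group `E` is a topological group, the
inclusion of `A` is a closed embedding onto a central subgroup, and the projection to `H` is an open
quotient map whose kernel is the image of `A`.  When `A` is finite and discrete and `H` is locally
compact Hausdorff, `E` is automatically locally compact Hausdorff. -/
structure TopCExt (A : Type*) (H : Type*) [CommGroup A] [TopologicalSpace A] [Group H]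
    [TopologicalSpace H] where
  carrier : Type*
  [group : Group carrier]
  [topologicalSpace : TopologicalSpace carrier]
  [isTopologicalGroup : IsTopologicalGroup carrier]
  inl : A →* carrier
  proj : carrier →* H
  isSES : TopologicalGroup.IsSES inl proj
  central : ∀ (a : A) (x : carrier), inl a * x = x * inl a

namespace TopCExt

attribute [instance] TopCExt.group TopCExt.topologicalSpace TopCExt.isTopologicalGroup

section

variable {A H : Type*} [CommGroup A] [TopologicalSpace A] [Group H] [TopologicalSpace H]

/-- Isomorphisms of topological central extensions: isomorphisms of topological groups inducing
the identity on `A` and on `H`. -/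
structure Iso (E E' : TopCExt A H) where
  toEquiv : E.carrier ≃ₜ* E'.carrier
  map_inl : ∀ a, toEquiv (E.inl a) = E'.inl a
  proj_map : ∀ x, E'.proj (toEquiv x) = E.proj x

theorem exists_inl_eq (E : TopCExt A H) {x : E.carrier} (hx : E.proj x = 1) : ∃ a, E.inl a = x :=
  (E.isSES.mulExact x).1 hx

theorem proj_inl (E : TopCExt A H) (a : A) : E.proj (E.inl a) = 1 :=
  (E.isSES.mulExact _).2 ⟨a, rfl⟩

theorem t1Space [T1Space A] (E : TopCExt A H) : T1Space E.carrier := by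
  refine IsTopologicalGroup.t1Space _ ?_
  simpa using E.isSES.isClosedEmbedding.isClosedMap _ (isClosed_singleton (x := (1 : A)))

theorem exists_comm (E : TopCExt A H) {h₁ h₂ : H} (h : Commute h₁ h₂) :
    ∃ a : A, ∀ x y : E.carrier, E.proj x = h₁ → E.proj y = h₂ →
      E.inl a = x * y * x⁻¹ * y⁻¹ := by
  obtain ⟨x₀, hx₀⟩ := E.isSES.isOpenQuotientMap.surjective h₁
  obtain ⟨y₀, hy₀⟩ := E.isSES.isOpenQuotientMap.surjective h₂
  obtain ⟨a, ha⟩ := E.exists_inl_eq (x := x₀ * y₀ * x₀⁻¹ * y₀⁻¹) (by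
    simp only [map_mul, map_inv, hx₀, hy₀, h.eq]; group)
  refine ⟨a, fun x y hx hy => ?_⟩
  obtain ⟨b, hb⟩ := E.exists_inl_eq (x := x * x₀⁻¹) (by simp [hx, hx₀])
  obtain ⟨c, hc⟩ := E.exists_inl_eq (x := y * y₀⁻¹) (by simp [hy, hy₀])
  have hx' : x = E.inl b * x₀ := by rw [hb]; group
  have hy' : y = E.inl c * y₀ := by rw [hc]; group
  have h1 : x * y = E.inl (b * c) * (x₀ * y₀) := by
    rw [hx', hy', map_mul, mul_assoc, ← mul_assoc x₀, ← E.central c x₀]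
    simp only [mul_assoc]
  have h2 : y * x = E.inl (b * c) * (y₀ * x₀) := by
    rw [hx', hy', mul_comm b c, map_mul, mul_assoc, ← mul_assoc y₀, ← E.central b y₀]
    simp only [mul_assoc]
  calc E.inl a = x₀ * y₀ * (y₀ * x₀)⁻¹ := by rw [ha]; group
    _ = E.inl (b * c) * (x₀ * y₀ * (y₀ * x₀)⁻¹) * (E.inl (b * c))⁻¹ := by
        rw [E.central]; group
    _ = (x * y) * (y * x)⁻¹ := by rw [h1, h2]; group
    _ = x * y * x⁻¹ * y⁻¹ := by group

/-- For commuting `h₁, h₂ : H`, the element `comm(h₁, h₂) = x y x⁻¹ y⁻¹` of `A`, for any preimages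
`x, y` of `h₁, h₂`. -/
noncomputable def comm (E : TopCExt A H) (h₁ h₂ : H) (h : Commute h₁ h₂) : A :=
  (E.exists_comm h).choose

theorem inl_comm (E : TopCExt A H) {h₁ h₂ : H} (h : Commute h₁ h₂) (x y : E.carrier)
    (hx : E.proj x = h₁) (hy : E.proj y = h₂) :
    E.inl (E.comm h₁ h₂ h) = x * y * x⁻¹ * y⁻¹ :=
  (E.exists_comm h).choose_spec x y hx hy

/-- The preimage of a subgroup `K` of `H`, as a topological central extension of `K` by `A`. -/
def restrict (E : TopCExt A H) (K : Subgroup H) : TopCExt A K where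
  carrier := K.comap E.proj
  inl := E.inl.codRestrict _ fun a => by simp [Subgroup.mem_comap, E.proj_inl, K.one_mem]
  proj := E.proj.subgroupComap K
  isSES :=
    { isClosedEmbedding := by
        refine ⟨.of_comp (g := ((↑) : K.comap E.proj → E.carrier))
          (E.isSES.isClosedEmbedding.continuous.subtype_mk _) continuous_subtype_val
          E.isSES.isClosedEmbedding.isEmbedding, ?_⟩
        convert E.isSES.isClosedEmbedding.isClosed_range.preimage
          (continuous_subtype_val (p := (· ∈ K.comap E.proj))) using 1
        ext x
        simp [Subtype.ext_iff]
      isOpenQuotientMap :=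
        { surjective := fun k => by
            obtain ⟨x, hx⟩ := E.isSES.isOpenQuotientMap.surjective k
            exact ⟨⟨x, by simp [Subgroup.mem_comap, hx]⟩, Subtype.ext hx⟩
          continuous := (E.isSES.isOpenQuotientMap.continuous.comp
            continuous_subtype_val).subtype_mk _
          isOpenMap := E.isSES.isOpenQuotientMap.isOpenMap.restrictPreimage (K : Set H) }
      mulExact := fun x => by
        have h := E.isSES.mulExact x.1
        simp only [Set.mem_range] at h ⊢
        rw [show E.proj.subgroupComap K x = 1 ↔ E.proj x.1 = 1 from Subtype.ext_iff, h]
        simp [Subtype.ext_iff] }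
  central a x := Subtype.ext (E.central a x)

/-- Transport of a topological central extension along an isomorphism of the base group. -/
def congr {H' : Type*} [Group H'] [TopologicalSpace H'] (φ : H ≃ₜ* H') (E : TopCExt A H) :
    TopCExt A H' where
  carrier := E.carrier
  inl := E.inl
  proj := (φ : H →* H').comp E.proj
  isSES :=
    { isClosedEmbedding := E.isSES.isClosedEmbedding
      isOpenQuotientMap := φ.toHomeomorph.isOpenQuotientMap.comp E.isSES.isOpenQuotientMap
      mulExact := fun x => by
        rw [← E.isSES.mulExact x]
        simp }
  central := E.central

end

section BaerSum

variable {A : Type*} [CommGroup A] [TopologicalSpace A]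
  {ι : Type*} [Fintype ι] {H : ι → Type*} [∀ i, Group (H i)] [∀ i, TopologicalSpace (H i)]

/-- The homomorphism `z ↦ ((∏ zᵢ)⁻¹, (zᵢ)ᵢ)` from `A^ι` to `A × ∏ Eᵢ`. -/
def antidiagonal (E : ∀ i, TopCExt A (H i)) : (ι → A) →* A × (∀ i, (E i).carrier) where
  toFun z := ((∏ i, z i)⁻¹, fun i => (E i).inl (z i))
  map_one' := by ext <;> simp
  map_mul' z w := by
    ext
    · simp [Finset.prod_mul_distrib, mul_comm]
    · simp

instance (E : ∀ i, TopCExt A (H i)) : (antidiagonal E).range.Normal where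
  conj_mem := by
    rintro _ ⟨z, rfl⟩ ⟨a, x⟩
    refine ⟨z, ?_⟩
    ext i
    · simp [antidiagonal, mul_comm]
    · simp [antidiagonal, ← (E i).central]

/-- The projection `A × ∏ Eᵢ → ∏ Hᵢ`, `(a, x) ↦ (pᵢ(xᵢ))ᵢ`. -/
def sumProj (E : ∀ i, TopCExt A (H i)) : A × (∀ i, (E i).carrier) →* ∀ i, H i :=
  (MonoidHom.pi fun i => (E i).proj.comp (Pi.evalMonoidHom _ i)).comp (MonoidHom.snd A _)

variable [Finite A] [DiscreteTopology A]

/-- The external Baer sum of the extensions `Eᵢ` of `Hᵢ` by `A`: the push-out of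
`1 → A^ι → ∏ Eᵢ → ∏ Hᵢ → 1` along the multiplication `A^ι → A`, that is, the quotient of
`A × ∏ Eᵢ` by the elements `((∏ zᵢ)⁻¹, (zᵢ)ᵢ)` with `z` in `A^ι`, with the quotient topology. -/
def externalBaerSum (E : ∀ i, TopCExt A (H i)) : TopCExt A (∀ i, H i) where
  carrier := (A × (∀ i, (E i).carrier)) ⧸ (antidiagonal E).range
  inl := (QuotientGroup.mk' _).comp (MonoidHom.inl A _)
  proj := QuotientGroup.lift _ (sumProj E) (by
    rintro _ ⟨z, rfl⟩
    ext i
    exact (E i).proj_inl (z i))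
  isSES :=
    { isClosedEmbedding := by
        have : ∀ i, T1Space (E i).carrier := fun i => (E i).t1Space
        have : IsClosed ((antidiagonal E).range : Set (A × (∀ i, (E i).carrier))) :=
          (Set.finite_range (antidiagonal E)).isClosed
        refine Continuous.isClosedEmbedding ?_ ?_
        · exact continuous_of_discreteTopology
        · intro a b hab
          obtain ⟨z, hz⟩ := (QuotientGroup.eq (s := (antidiagonal E).range)).1 hab
          have hz1 : ∀ i, z i = 1 := fun i =>
            (E i).isSES.isClosedEmbedding.injective <| by
              have := congrFun (congrArg Prod.snd hz) i
              simpa [antidiagonal] using this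
          have hz2 := congrArg Prod.fst hz
          simp only [antidiagonal, MonoidHom.coe_mk, OneHom.coe_mk, hz1, Finset.prod_const_one,
            inv_one, MonoidHom.inl_apply, Prod.fst_mul, Prod.fst_inv] at hz2
          exact (inv_mul_eq_one.1 hz2.symm)
      isOpenQuotientMap := by
        have h : IsOpenQuotientMap (sumProj E) :=
          (IsOpenQuotientMap.piMap fun i => (E i).isSES.isOpenQuotientMap).comp
            ⟨Prod.snd_surjective, continuous_snd, isOpenMap_snd⟩
        exact .of_comp continuous_quot_mk Quot.mk_surjective
          (continuous_quot_lift _ h.continuous) h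
      mulExact := fun x => by
        obtain ⟨⟨b, y⟩, rfl⟩ := QuotientGroup.mk_surjective x
        constructor
        · intro h
          choose z hz using fun i => (E i).exists_inl_eq (congrFun h i)
          refine ⟨b * ∏ i, z i, QuotientGroup.eq.2 ⟨z, ?_⟩⟩
          ext i
          · simp [antidiagonal]
          · simp [antidiagonal, hz]
        · rintro ⟨a, ha⟩
          rw [← ha]
          ext i
          simp [sumProj] }
  central a x := by
    obtain ⟨⟨b, y⟩, rfl⟩ := QuotientGroup.mk_surjective x
    simp only [MonoidHom.comp_apply, QuotientGroup.mk'_apply, ← QuotientGroup.mk_mul]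
    congr 1
    ext <;> simp [mul_comm]

end BaerSum

end TopCExt

/-- A quadratic space over `F` with underlying vector space `V`: a non-degenerate symmetric
bilinear form on `V`. -/
structure QuadSpace (F V : Type*) [Field F] [AddCommGroup V] [Module F V] where
  form : LinearMap.BilinForm F V
  symm : form.IsSymm
  nondegenerate : form.Nondegenerate

namespace QuadSpace

variable {F V : Type*} [Field F] [AddCommGroup V] [Module F V]

/-- The full orthogonal group `O(V)(F)`. -/
def O (q : QuadSpace F V) : Subgroup (V ≃ₗ[F] V) where
  carrier := {g | ∀ x y, q.form (g x) (g y) = q.form x y}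
  mul_mem' {g h} hg hh x y := by simp [LinearEquiv.mul_apply, hg (h x) (h y), hh x y]
  one_mem' x y := rfl
  inv_mem' {g} hg x y := by
    rw [← hg]
    simp

/-- The special orthogonal group `SO(V)(F)`, as a subgroup of `O(V)(F)`. -/
noncomputable def SO (q : QuadSpace F V) : Subgroup q.O :=
  (LinearEquiv.det.comp q.O.subtype).ker

/-- The topology of `O(V)(F)`: the subspace topology inside `End(V)`, where the `F`-vector space
`End(V)` has its canonical topology. -/
instance [TopologicalSpace F] (q : QuadSpace F V) : TopologicalSpace q.O :=
  (moduleTopology F (V →ₗ[F] V)).induced fun g => ((g : V ≃ₗ[F] V) : V →ₗ[F] V)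

/-- An orthogonal decomposition `V = ⨁ (ℓᵢ ⊕ ℓᵢ') ⊕ V♭` with `ℓᵢ ⊕ ℓᵢ'` and `V♭` non-degenerate,
`ℓᵢ` and `ℓᵢ'` totally isotropic of the same positive dimension, and `V♭` nonzero. -/
structure LeviDatum (q : QuadSpace F V) where
  r : ℕ
  ℓ : Fin r → Submodule F V
  ℓ' : Fin r → Submodule F V
  flat : Submodule F V
  isInternal : DirectSum.IsInternal (Sum.elim (Sum.elim ℓ ℓ') fun _ : Unit => flat)
  orthogonal : ∀ i j, i ≠ j → ∀ x ∈ ℓ i ⊔ ℓ' i, ∀ y ∈ ℓ j ⊔ ℓ' j, q.form x y = 0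
  orthogonal_flat : ∀ i, ∀ x ∈ ℓ i ⊔ ℓ' i, ∀ y ∈ flat, q.form x y = 0
  isotropic : ∀ i, ∀ x ∈ ℓ i, ∀ y ∈ ℓ i, q.form x y = 0
  isotropic' : ∀ i, ∀ x ∈ ℓ' i, ∀ y ∈ ℓ' i, q.form x y = 0
  nondegenerate : ∀ i, (q.form.restrict (ℓ i ⊔ ℓ' i)).Nondegenerate
  nondegenerate_flat : (q.form.restrict flat).Nondegenerate
  finrank_pos : ∀ i, 1 ≤ Module.finrank F (ℓ i)
  finrank_eq : ∀ i, Module.finrank F (ℓ' i) = Module.finrank F (ℓ i)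
  flat_ne_bot : flat ≠ ⊥

namespace LeviDatum

variable {q : QuadSpace F V} (D : q.LeviDatum)

/-- The summands `ℓᵢ`, `ℓᵢ'` and `V♭`. -/
def piece : (Fin D.r ⊕ Fin D.r) ⊕ Unit → Submodule F V :=
  Sum.elim (Sum.elim D.ℓ D.ℓ') fun _ => D.flat

/-- The orthogonal summands `ℓᵢ ⊕ ℓᵢ'` (index `some i`) and `V♭` (index `none`). -/
def block : Option (Fin D.r) → Submodule F V
  | some i => D.ℓ i ⊔ D.ℓ' i
  | none => D.flat

/-- The Levi subgroup `M⁺(F)` of `O(V)(F)`: the stabilizer of all `ℓᵢ`, `ℓᵢ'` and `V♭`. -/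
def leviO : Subgroup q.O where
  carrier := {g | ∀ s, ∀ x, (g : V ≃ₗ[F] V) x ∈ D.piece s ↔ x ∈ D.piece s}
  mul_mem' {g h} hg hh s x := by
    simp [LinearEquiv.mul_apply, hg s ((h : V ≃ₗ[F] V) x), hh s x]
  one_mem' s x := Iff.rfl
  inv_mem' {g} hg s x := by
    rw [← hg s]
    simp

/-- The Levi subgroup `M(F) = M⁺(F) ∩ SO(V)(F)` of `SO(V)(F)`; `M` is the identity component of
`M⁺`. -/
noncomputable def leviSO : Subgroup q.O := D.leviO ⊓ q.SO

/-- The factors of `M⁺(F)`: the elements of `M⁺(F)` that are the identity on all but one of the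
summands `ℓᵢ ⊕ ℓᵢ'` and `V♭`.  For `some i` this is the group `GL(ℓᵢ)`, whose elements act on `ℓᵢ'`
by the contragredient with respect to the form; for `none` it is `O(V♭)(F)`. -/
def factorO (o : Option (Fin D.r)) : Subgroup q.O where
  carrier := {g | g ∈ D.leviO ∧ ∀ o', o' ≠ o → ∀ x ∈ D.block o', (g : V ≃ₗ[F] V) x = x}
  mul_mem' {g h} hg hh := ⟨mul_mem hg.1 hh.1, fun o' ho x hx => by
    simp [LinearEquiv.mul_apply, hg.2 o' ho x hx, hh.2 o' ho x hx]⟩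
  one_mem' := ⟨one_mem _, fun _ _ _ _ => rfl⟩
  inv_mem' {g} hg := ⟨inv_mem hg.1, fun o' ho x hx => by
    conv_lhs => rw [← hg.2 o' ho x hx]
    simp [← LinearEquiv.mul_apply]⟩

/-- The factors of `M(F)`: the groups `GL(ℓᵢ)` and `SO(V♭)(F)`. -/
noncomputable def factorSO : Option (Fin D.r) → Subgroup q.O
  | some i => D.factorO (some i)
  | none => D.factorO none ⊓ q.SO

/-- The diagonal torus of `GL(ℓᵢ)` with respect to a basis of `ℓᵢ`. -/
def diagonalTorus (i : Fin D.r) {n : ℕ} (b : Module.Basis (Fin n) F (D.ℓ i)) :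
    Set q.O :=
  {t | t ∈ D.factorO (some i) ∧ ∀ k, ∃ a : F, (t : V ≃ₗ[F] V) (b k) = a • (b k : V)}

/-! ### The product decompositions of `M⁺(F)` and `M(F)` -/

theorem factorO_le (o : Option (Fin D.r)) : D.factorO o ≤ D.leviO := fun _ hg => hg.1

theorem factorSO_le (o : Option (Fin D.r)) : D.factorSO o ≤ D.factorO o := by
  cases o
  · exact inf_le_left
  · exact le_rfl

theorem mem_block {g : q.O} (hg : g ∈ D.leviO) {o : Option (Fin D.r)} {x : V}
    (hx : x ∈ D.block o) : (g : V ≃ₗ[F] V) x ∈ D.block o := by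
  cases o with
  | none => exact (hg (.inr ()) x).2 hx
  | some i =>
    obtain ⟨y, hy, z, hz, rfl⟩ := Submodule.mem_sup.1 hx
    rw [map_add]
    exact Submodule.add_mem_sup ((hg (.inl (.inl i)) y).2 hy) ((hg (.inl (.inr i)) z).2 hz)

theorem iSup_block : ⨆ o, D.block o = ⊤ := by
  rw [eq_top_iff, ← D.isInternal.submodule_iSup_eq_top]
  refine iSup_le ?_
  rintro ((i | i) | _)
  · exact le_trans le_sup_left (le_iSup D.block (some i))
  · exact le_trans le_sup_right (le_iSup D.block (some i))
  · exact le_iSup D.block none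

theorem ext_block {f g : V →ₗ[F] V} (h : ∀ o, ∀ x ∈ D.block o, f x = g x) : f = g := by
  ext x
  have hx : x ∈ ⨆ o, D.block o := by rw [D.iSup_block]; trivial
  induction hx using Submodule.iSup_induction' with
  | mem o x hx => exact h o x hx
  | zero => simp
  | add x y _ _ hx hy => simp [hx, hy]

theorem ext_O {f g : q.O}
    (h : ∀ o, ∀ x ∈ D.block o, (f : V ≃ₗ[F] V) x = (g : V ≃ₗ[F] V) x) : f = g :=
  Subtype.ext <| LinearEquiv.toLinearMap_injective <| D.ext_block h

theorem commute_of_mem {o o' : Option (Fin D.r)} (h : o ≠ o') (f g : q.O)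
    (hf : f ∈ D.factorO o) (hg : g ∈ D.factorO o') : Commute f g := by
  refine D.ext_O fun p x hx => ?_
  simp only [Subgroup.coe_mul, LinearEquiv.mul_apply]
  rcases eq_or_ne p o with rfl | hp
  · rw [hg.2 p h x hx, hg.2 p h _ (D.mem_block hf.1 hx)]
  · rw [hf.2 p hp x hx, hf.2 p hp _ (D.mem_block hg.1 hx)]

theorem pairwise_commute (K : Option (Fin D.r) → Subgroup q.O) (hK : ∀ o, K o ≤ D.factorO o) :
    Pairwise fun o o' => ∀ x y : q.O, x ∈ K o → y ∈ K o' → Commute x y :=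
  fun _ _ h x y hx hy => D.commute_of_mem h x y (hK _ hx) (hK _ hy)

theorem prod_apply (K : Option (Fin D.r) → Subgroup q.O) (hK : ∀ o, K o ≤ D.factorO o)
    (k : ∀ o, K o) (o : Option (Fin D.r)) {x : V} (hx : x ∈ D.block o) :
    (Subgroup.noncommPiCoprod (D.pairwise_commute K hK) k : V ≃ₗ[F] V) x =
      ((k o : q.O) : V ≃ₗ[F] V) x := by
  have hk : k = Pi.mulSingle o (k o) * Function.update k o 1 := by
    funext p
    rcases eq_or_ne p o with rfl | hp
    · simp
    · simp [hp]
  let S : Subgroup q.O :=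
    { carrier := {g | (g : V ≃ₗ[F] V) x = x}
      mul_mem' := fun {g h} hg hh => by
        simp only [Set.mem_ofPred_eq, Subgroup.coe_mul, LinearEquiv.mul_apply] at *
        rw [hh, hg]
      one_mem' := rfl
      inv_mem' := fun {g} hg => by
        simp only [Set.mem_ofPred_eq] at *
        conv_lhs => rw [← hg]
        simp [← LinearEquiv.mul_apply] }
  have hS : Subgroup.noncommPiCoprod (D.pairwise_commute K hK) (Function.update k o 1) ∈ S := by
    refine Subgroup.noncommProd_mem S _ fun p _ => ?_
    rcases eq_or_ne p o with rfl | hp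
    · simp only [Function.update_self, map_one]
      exact S.one_mem
    · simp only [Function.update_of_ne hp]
      exact (hK p (k p).2).2 o (Ne.symm hp) x hx
  conv_lhs => rw [hk, map_mul, Subgroup.noncommPiCoprod_mulSingle]
  simp only [Subgroup.coe_mul, LinearEquiv.mul_apply]
  rw [show (Subgroup.noncommPiCoprod (D.pairwise_commute K hK) (Function.update k o 1) :
    V ≃ₗ[F] V) x = x from hS]

/-- The projection of `V` onto a summand `ℓᵢ`, `ℓᵢ'` or `V♭`. -/
noncomputable def pieceProj (s : (Fin D.r ⊕ Fin D.r) ⊕ Unit) : V →ₗ[F] V :=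
  (D.piece s).subtype ∘ₗ DirectSum.component F _ (fun s => D.piece s) s ∘ₗ
    (LinearEquiv.ofBijective (DirectSum.coeLinearMap D.piece) D.isInternal).symm.toLinearMap

theorem pieceProj_self {s} {x : V} (hx : x ∈ D.piece s) : D.pieceProj s x = x := by
  have := D.isInternal.ofBijective_coeLinearMap_of_mem hx
  exact congrArg Subtype.val this

theorem pieceProj_of_ne {s t} (h : s ≠ t) {x : V} (hx : x ∈ D.piece s) :
    D.pieceProj t x = 0 := by
  have := D.isInternal.ofBijective_coeLinearMap_of_mem_ne h hx
  exact congrArg Subtype.val this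

/-- The projection of `V` onto a summand `ℓᵢ ⊕ ℓᵢ'` or `V♭`. -/
noncomputable def blockProj : Option (Fin D.r) → V →ₗ[F] V
  | some i => D.pieceProj (.inl (.inl i)) + D.pieceProj (.inl (.inr i))
  | none => D.pieceProj (.inr ())

theorem blockProj_self {o} {x : V} (hx : x ∈ D.block o) : D.blockProj o x = x := by
  cases o with
  | none => exact D.pieceProj_self (s := .inr ()) hx
  | some i =>
    obtain ⟨y, hy, z, hz, rfl⟩ := Submodule.mem_sup.1 hx
    simp only [blockProj, LinearMap.add_apply, map_add]
    rw [D.pieceProj_self (s := .inl (.inl i)) hy, D.pieceProj_self (s := .inl (.inr i)) hz,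
      D.pieceProj_of_ne (s := .inl (.inl i)) (by simp) hy,
      D.pieceProj_of_ne (s := .inl (.inr i)) (by simp) hz]
    simp

theorem blockProj_of_ne {o o'} (h : o ≠ o') {x : V} (hx : x ∈ D.block o) :
    D.blockProj o' x = 0 := by
  cases o with
  | none =>
    cases o' with
    | none => exact absurd rfl h
    | some j =>
      simp only [blockProj, LinearMap.add_apply]
      rw [D.pieceProj_of_ne (s := .inr ()) (by simp) hx,
        D.pieceProj_of_ne (s := .inr ()) (by simp) hx, add_zero]
  | some i =>
    obtain ⟨y, hy, z, hz, rfl⟩ := Submodule.mem_sup.1 hx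
    cases o' with
    | none =>
      simp only [blockProj, map_add]
      rw [D.pieceProj_of_ne (s := .inl (.inl i)) (by simp) hy,
        D.pieceProj_of_ne (s := .inl (.inr i)) (by simp) hz, add_zero]
    | some j =>
      have hij : i ≠ j := fun e => h (congrArg some e)
      simp only [blockProj, LinearMap.add_apply, map_add]
      rw [D.pieceProj_of_ne (s := .inl (.inl i)) (by simpa using hij) hy,
        D.pieceProj_of_ne (s := .inl (.inr i)) (by simp) hz,
        D.pieceProj_of_ne (s := .inl (.inl i)) (by simp) hy,
        D.pieceProj_of_ne (s := .inl (.inr i)) (by simpa using hij) hz]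
      simp

theorem form_eq_zero {o o'} (h : o ≠ o') {x y : V} (hx : x ∈ D.block o) (hy : y ∈ D.block o') :
    q.form x y = 0 := by
  cases o with
  | none =>
    cases o' with
    | none => exact absurd rfl h
    | some j => rw [← q.symm.eq]; exact D.orthogonal_flat j y hy x hx
  | some i =>
    cases o' with
    | none => exact D.orthogonal_flat i x hx y hy
    | some j => exact D.orthogonal i j (fun e => h (congrArg some e)) x hx y hy

/-- The endomorphism of `V` that agrees with `g` on one summand `ℓᵢ ⊕ ℓᵢ'` or `V♭` and is the
identity on the others. -/
noncomputable def componentMap (g : V →ₗ[F] V) (o : Option (Fin D.r)) : V →ₗ[F] V :=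
  g ∘ₗ D.blockProj o + (LinearMap.id - D.blockProj o)

theorem componentMap_self (g : V →ₗ[F] V) {o} {x : V} (hx : x ∈ D.block o) :
    D.componentMap g o x = g x := by
  simp [componentMap, D.blockProj_self hx]

theorem componentMap_of_ne (g : V →ₗ[F] V) {o o'} (h : o ≠ o') {x : V} (hx : x ∈ D.block o) :
    D.componentMap g o' x = x := by
  simp [componentMap, D.blockProj_of_ne h hx]

theorem componentMap_comp {f g : q.O} (hg : g ∈ D.leviO) (hfg : f * g = 1) (o) :
    D.componentMap (f : V ≃ₗ[F] V) o ∘ₗ D.componentMap (g : V ≃ₗ[F] V) o = LinearMap.id := by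
  refine D.ext_block fun p x hx => ?_
  rcases eq_or_ne p o with rfl | hp
  · rw [LinearMap.comp_apply, D.componentMap_self _ hx, LinearEquiv.coe_coe,
      D.componentMap_self _ (D.mem_block hg hx)]
    exact LinearEquiv.congr_fun (congrArg Subtype.val hfg) x
  · rw [LinearMap.comp_apply, D.componentMap_of_ne _ hp hx, D.componentMap_of_ne _ hp hx]
    rfl

theorem piece_le_block (s) : ∃ o, D.piece s ≤ D.block o := by
  rcases s with (i | i) | _
  · exact ⟨some i, le_sup_left⟩
  · exact ⟨some i, le_sup_right⟩
  · exact ⟨none, le_rfl⟩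

theorem componentMap_mem {g : q.O} (hg : g ∈ D.leviO) (o s) {x : V} (hx : x ∈ D.piece s) :
    D.componentMap (g : V ≃ₗ[F] V) o x ∈ D.piece s := by
  obtain ⟨p, hp⟩ := D.piece_le_block s
  rcases eq_or_ne p o with rfl | h
  · rw [D.componentMap_self _ (hp hx)]
    exact (hg s x).2 hx
  · rwa [D.componentMap_of_ne _ h (hp hx)]

theorem form_ext_block {f g : V →ₗ[F] V →ₗ[F] F}
    (h : ∀ o, ∀ x ∈ D.block o, ∀ o', ∀ y ∈ D.block o', f x y = g x y) : f = g := by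
  ext x y
  have hx : x ∈ ⨆ o, D.block o := by rw [D.iSup_block]; trivial
  have hy : y ∈ ⨆ o, D.block o := by rw [D.iSup_block]; trivial
  induction hx using Submodule.iSup_induction' with
  | mem o x hx =>
    induction hy using Submodule.iSup_induction' with
    | mem o' y hy => exact h o x hx o' y hy
    | zero => simp
    | add y z _ _ hy hz => simp [hy, hz]
  | zero => simp
  | add x z _ _ hx hz => simp [hx, hz]

theorem exists_component {g : q.O} (hg : g ∈ D.leviO) (o : Option (Fin D.r)) :
    ∃ c ∈ D.factorO o, ((c : V ≃ₗ[F] V) : V →ₗ[F] V) = D.componentMap (g : V ≃ₗ[F] V) o := by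
  have hg' : g⁻¹ ∈ D.leviO := inv_mem hg
  have h1 := D.componentMap_comp hg (inv_mul_cancel g) o
  have h2 := D.componentMap_comp hg' (mul_inv_cancel g) o
  let e : V ≃ₗ[F] V := LinearEquiv.ofLinearMap (D.componentMap (g : V ≃ₗ[F] V) o)
    (D.componentMap ((g⁻¹ : q.O) : V ≃ₗ[F] V) o) h2 h1
  have he : ∀ x, e x = D.componentMap (g : V ≃ₗ[F] V) o x := fun _ => rfl
  have heO : e ∈ q.O := by
    have : q.form.compl₁₂ (e : V →ₗ[F] V) (e : V →ₗ[F] V) = q.form := by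
      refine D.form_ext_block fun p x hx p' y hy => ?_
      simp only [LinearMap.compl₁₂_apply, LinearEquiv.coe_coe, he]
      rcases eq_or_ne p p' with rfl | hp
      · rcases eq_or_ne p o with rfl | hpo
        · rw [D.componentMap_self _ hx, D.componentMap_self _ hy]
          exact g.2 x y
        · rw [D.componentMap_of_ne _ hpo hx, D.componentMap_of_ne _ hpo hy]
      · have key : ∀ p, ∀ x ∈ D.block p, D.componentMap (g : V ≃ₗ[F] V) o x ∈ D.block p := by
          intro p x hx
          rcases eq_or_ne p o with rfl | hpo
          · rw [D.componentMap_self _ hx]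
            exact D.mem_block hg hx
          · rwa [D.componentMap_of_ne _ hpo hx]
        rw [D.form_eq_zero hp (key p x hx) (key p' y hy), D.form_eq_zero hp hx hy]
    exact fun x y => LinearMap.congr_fun₂ this x y
  refine ⟨⟨e, heO⟩, ⟨fun s x => ⟨fun h => ?_, fun h => D.componentMap_mem hg o s h⟩,
    fun o' ho x hx => D.componentMap_of_ne _ ho hx⟩, rfl⟩
  have := D.componentMap_mem hg' o s h
  rwa [show D.componentMap ((g⁻¹ : q.O) : V ≃ₗ[F] V) o (e x) = x from
    LinearMap.congr_fun h1 x] at this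

theorem ext_piece {f g : V →ₗ[F] V} (h : ∀ s, ∀ x ∈ D.piece s, f x = g x) : f = g := by
  ext x
  have hx : x ∈ ⨆ s, D.piece s := by
    rw [show ⨆ s, D.piece s = ⊤ from D.isInternal.submodule_iSup_eq_top]; trivial
  induction hx using Submodule.iSup_induction' with
  | mem o x hx => exact h o x hx
  | zero => simp
  | add x y _ _ hx hy => simp [hx, hy]

theorem form_ext_piece {f g : V →ₗ[F] V →ₗ[F] F}
    (h : ∀ s, ∀ x ∈ D.piece s, ∀ t, ∀ y ∈ D.piece t, f x y = g x y) : f = g := by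
  ext x y
  have hx : x ∈ ⨆ s, D.piece s := by
    rw [show ⨆ s, D.piece s = ⊤ from D.isInternal.submodule_iSup_eq_top]; trivial
  have hy : y ∈ ⨆ s, D.piece s := by
    rw [show ⨆ s, D.piece s = ⊤ from D.isInternal.submodule_iSup_eq_top]; trivial
  induction hx using Submodule.iSup_induction' with
  | mem o x hx =>
    induction hy using Submodule.iSup_induction' with
    | mem o' y hy => exact h o x hx o' y hy
    | zero => simp
    | add y z _ _ hy hz => simp [hy, hz]
  | zero => simp
  | add x z _ _ hx hz => simp [hx, hz]

theorem mem_SO_of_mem_factorO [FiniteDimensional F V] (i : Fin D.r) {g : q.O}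
    (hg : g ∈ D.factorO (some i)) : g ∈ q.SO := by
  let G : V →ₗ[F] V := ((g : V ≃ₗ[F] V) : V →ₗ[F] V)
  let cm (s) : V →ₗ[F] V := G ∘ₗ D.pieceProj s + (LinearMap.id - D.pieceProj s)
  have cm_self : ∀ s x, x ∈ D.piece s → cm s x = G x := fun s x hx => by
    simp [cm, D.pieceProj_self hx]
  have cm_ne : ∀ s t x, s ≠ t → x ∈ D.piece s → cm t x = x := fun s t x h hx => by
    simp [cm, D.pieceProj_of_ne h hx]
  have hG : ∀ s x, x ∈ D.piece s → G x ∈ D.piece s := fun s x hx => (hg.1 s x).2 hx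
  have hGfix : ∀ s, s ≠ .inl (.inl i) → s ≠ .inl (.inr i) → ∀ x ∈ D.piece s, G x = x := by
    rintro ((j | j) | _) h1 h2 x hx
    · exact hg.2 (some j) (by rintro ⟨⟩; exact h1 rfl) x (Submodule.mem_sup_left hx)
    · exact hg.2 (some j) (by rintro ⟨⟩; exact h2 rfl) x (Submodule.mem_sup_right hx)
    · exact hg.2 none (by simp) x hx
  have hzero : ∀ s t, ∀ x ∈ D.piece s, ∀ y ∈ D.piece t,
      (s = .inl (.inl i) ∧ t ≠ .inl (.inr i)) ∨ (t = .inl (.inr i) ∧ s ≠ .inl (.inl i)) →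
      q.form x y = 0 := by
    rintro s t x hx y hy (⟨rfl, ht⟩ | ⟨rfl, hs⟩)
    · rcases t with (j | j) | _
      · rcases eq_or_ne i j with rfl | hij
        · exact D.isotropic i x hx y hy
        · exact D.orthogonal i j hij x (Submodule.mem_sup_left hx) y (Submodule.mem_sup_left hy)
      · exact D.orthogonal i j (by rintro rfl; exact ht rfl) x (Submodule.mem_sup_left hx) y
          (Submodule.mem_sup_right hy)
      · exact D.orthogonal_flat i x (Submodule.mem_sup_left hx) y hy
    · rw [← q.symm.eq]
      rcases s with (j | j) | _
      · exact D.orthogonal i j (by rintro rfl; exact hs rfl) y (Submodule.mem_sup_right hy) x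
          (Submodule.mem_sup_left hx)
      · rcases eq_or_ne i j with rfl | hij
        · exact D.isotropic' i y hy x hx
        · exact D.orthogonal i j hij y (Submodule.mem_sup_right hy) x (Submodule.mem_sup_right hx)
      · exact D.orthogonal_flat i y (Submodule.mem_sup_right hy) x hx
  have hab : cm (.inl (.inl i)) ∘ₗ cm (.inl (.inr i)) = G := by
    refine D.ext_piece fun s x hx => ?_
    rw [LinearMap.comp_apply]
    by_cases h2 : s = .inl (.inr i)
    · subst h2
      rw [cm_self _ _ hx, cm_ne _ _ _ (by simp) (hG _ _ hx)]
    · rw [cm_ne _ _ _ h2 hx]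
      by_cases h1 : s = .inl (.inl i)
      · subst h1
        rw [cm_self _ _ hx]
      · rw [cm_ne _ _ _ h1 hx, hGfix s h1 h2 x hx]
  have hform : q.form.comp (cm (.inl (.inl i))) (cm (.inl (.inr i))) = q.form := by
    refine D.form_ext_piece fun s x hx t y hy => ?_
    rw [LinearMap.BilinForm.comp_apply]
    by_cases h1 : s = .inl (.inl i) <;> by_cases h2 : t = .inl (.inr i)
    · subst h1 h2
      rw [cm_self _ _ hx, cm_self _ _ hy]
      exact g.2 x y
    · subst h1
      rw [cm_self _ _ hx, cm_ne _ _ _ h2 hy, hzero _ t _ (hG _ x hx) y hy (.inl ⟨rfl, h2⟩),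
        hzero _ t _ hx y hy (.inl ⟨rfl, h2⟩)]
    · subst h2
      rw [cm_self _ _ hy, cm_ne _ _ _ h1 hx, hzero s _ _ hx _ (hG _ y hy) (.inr ⟨rfl, h1⟩),
        hzero s _ _ hx y hy (.inr ⟨rfl, h1⟩)]
    · rw [cm_ne _ _ _ h1 hx, cm_ne _ _ _ h2 hy]
  have hdet : LinearMap.det G = 1 := by
    rw [← hab, LinearMap.det_comp]
    let b := Module.finBasis F V
    have h := congrArg (fun B => (LinearMap.BilinForm.toMatrix b B).det) hform
    simp only [LinearMap.BilinForm.toMatrix_comp b b, Matrix.det_mul, Matrix.det_transpose,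
      LinearMap.det_toMatrix] at h
    have hJ := (LinearMap.BilinForm.nondegenerate_iff_det_ne_zero b).1 q.nondegenerate
    refine mul_right_cancel₀ hJ ?_
    rw [one_mul]
    nth_rw 2 [← h]
    ring
  refine MonoidHom.mem_ker.2 (Units.ext ?_)
  simpa [G] using hdet

theorem prod_mem (K : Option (Fin D.r) → Subgroup q.O) (hK : ∀ o, K o ≤ D.factorO o)
    (N : Subgroup q.O) (hKN : ∀ o, K o ≤ N) (k : ∀ o, K o) :
    Subgroup.noncommPiCoprod (D.pairwise_commute K hK) k ∈ N := by
  rw [Subgroup.noncommPiCoprod_apply]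
  refine Subgroup.noncommProd_mem N _ fun o _ => ?_
  exact hKN o (k o).2

theorem isInducing_O [TopologicalSpace F] (q : QuadSpace F V) :
    @Topology.IsInducing _ _ _ (moduleTopology F (V →ₗ[F] V))
      (fun g : q.O => ((g : V ≃ₗ[F] V) : V →ₗ[F] V)) :=
  @Topology.IsInducing.mk _ _ _ (_) _ rfl

theorem factorSO_le_leviSO [FiniteDimensional F V] (o : Option (Fin D.r)) :
    D.factorSO o ≤ D.leviSO := by
  cases o with
  | none => exact inf_le_inf_right _ (D.factorO_le none)
  | some i => exact fun g hg => ⟨hg.1, D.mem_SO_of_mem_factorO i hg⟩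

theorem mem_factorSO_of_eq [FiniteDimensional F V] {g : q.O} (hg : g ∈ D.leviSO)
    {o : Option (Fin D.r)} {c : q.O} (hc : c ∈ D.factorO o)
    (hcg : ∀ x ∈ D.block o, (c : V ≃ₗ[F] V) x = (g : V ≃ₗ[F] V) x) : c ∈ D.factorSO o := by
  cases o with
  | some i => exact hc
  | none =>
    refine ⟨hc, ?_⟩
    choose d hdm hde using D.exists_component hg.1
    have hd : ∀ o, ∀ x ∈ D.block o, (d o : V ≃ₗ[F] V) x = (g : V ≃ₗ[F] V) x :=
      fun o x hx => (LinearMap.congr_fun (hde o) x).trans (D.componentMap_self _ hx)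
    let K : Option (Fin D.r) → Subgroup q.O := fun o => D.factorO o ⊓ q.SO
    have hK : ∀ o, K o ≤ D.factorO o := fun _ => inf_le_left
    let k : ∀ o, K o := fun o => match o with
      | none => 1
      | some i => ⟨d (some i), hdm _, D.mem_SO_of_mem_factorO i (hdm _)⟩
    have hk := D.prod_mem K hK q.SO (fun _ => inf_le_right) k
    have hgc : g = c * Subgroup.noncommPiCoprod (D.pairwise_commute K hK) k := by
      refine D.ext_O fun p x hx => ?_
      rw [Subgroup.coe_mul, LinearEquiv.mul_apply, D.prod_apply K hK k p hx]
      cases p with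
      | none => exact (hcg x hx).symm
      | some i =>
        rw [hc.2 (some i) (by simp) _ (D.mem_block (hdm (some i)).1 hx)]
        exact (hd _ x hx).symm
    exact (Subgroup.mul_mem_cancel_right _ hk).1 (hgc ▸ hg.2)

/-- Multiplication `∏ₒ K o → N` in `O(V)(F)` as an isomorphism of groups, for suitable subgroups. -/
noncomputable def productMulEquiv (K : Option (Fin D.r) → Subgroup q.O) (N : Subgroup q.O)
    (hK : ∀ o, K o ≤ D.factorO o) (hN : N ≤ D.leviO) (hKN : ∀ o, K o ≤ N)
    (hc : ∀ g ∈ N, ∀ o, ∀ c ∈ D.factorO o,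
      (∀ x ∈ D.block o, (c : V ≃ₗ[F] V) x = (g : V ≃ₗ[F] V) x) → c ∈ K o) :
    (∀ o, K o) ≃* N :=
  MulEquiv.ofBijective
    ((Subgroup.noncommPiCoprod (D.pairwise_commute K hK)).codRestrict N fun k =>
      D.prod_mem K hK N hKN k) <| by
    constructor
    · intro k k' h
      funext o
      refine Subtype.ext (D.ext_O fun p x hx => ?_)
      rcases eq_or_ne p o with rfl | hp
      · rw [← D.prod_apply K hK k p hx, ← D.prod_apply K hK k' p hx]
        rw [show Subgroup.noncommPiCoprod (D.pairwise_commute K hK) k =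
          Subgroup.noncommPiCoprod (D.pairwise_commute K hK) k' from congrArg Subtype.val h]
      · rw [(hK o (k o).2).2 p hp x hx, (hK o (k' o).2).2 p hp x hx]
    · rintro ⟨g, hg⟩
      choose c hcm hce using D.exists_component (hN hg)
      have hcg : ∀ o, ∀ x ∈ D.block o, (c o : V ≃ₗ[F] V) x = (g : V ≃ₗ[F] V) x :=
        fun o x hx => (LinearMap.congr_fun (hce o) x).trans (D.componentMap_self _ hx)
      refine ⟨fun o => ⟨c o, hc g hg o (c o) (hcm o) (hcg o)⟩, Subtype.ext (D.ext_O ?_)⟩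
      exact fun o x hx => (D.prod_apply K hK _ o hx).trans (hcg o x hx)

section

variable [TopologicalSpace F] [IsTopologicalRing F] [FiniteDimensional F V]

/-- `productMulEquiv` as an isomorphism of topological groups. -/
noncomputable def productEquiv (K : Option (Fin D.r) → Subgroup q.O) (N : Subgroup q.O)
    (hK : ∀ o, K o ≤ D.factorO o) (hN : N ≤ D.leviO) (hKN : ∀ o, K o ≤ N)
    (hc : ∀ g ∈ N, ∀ o, ∀ c ∈ D.factorO o,
      (∀ x ∈ D.block o, (c : V ≃ₗ[F] V) x = (g : V ≃ₗ[F] V) x) → c ∈ K o) :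
    (∀ o, K o) ≃ₜ* N where
  toMulEquiv := D.productMulEquiv K N hK hN hKN hc
  continuous_toFun := by
    let : TopologicalSpace (Module.End F V) := moduleTopology F (Module.End F V)
    have : IsModuleTopology F (Module.End F V) := ⟨rfl⟩
    have := IsModuleTopology.isTopologicalRing F (Module.End F V)
    have hi := isInducing_O q
    refine (hi.comp Topology.IsInducing.subtypeVal).continuous_iff.2 ?_
    have h : ∀ k : ∀ o, K o,
        ((Subgroup.noncommPiCoprod (D.pairwise_commute K hK) k : V ≃ₗ[F] V) : Module.End F V) =
        ∑ o, (((k o : q.O) : V ≃ₗ[F] V) : Module.End F V) * (D.blockProj o : Module.End F V) := by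
      intro k
      refine D.ext_block fun p x hx => ?_
      rw [LinearMap.sum_apply, Finset.sum_eq_single p]
      · simpa [D.blockProj_self hx] using D.prod_apply K hK k p hx
      · intro o _ ho
        simp [D.blockProj_of_ne ho.symm hx]
      · simp
    refine (continuous_congr h).2 ?_
    refine continuous_finsetSum _ fun o _ => Continuous.mul ?_ continuous_const
    exact hi.continuous.comp (continuous_subtype_val.comp (continuous_apply o))
  continuous_invFun := by
    let : TopologicalSpace (Module.End F V) := moduleTopology F (Module.End F V)
    have : IsModuleTopology F (Module.End F V) := ⟨rfl⟩
    have := IsModuleTopology.isTopologicalRing F (Module.End F V)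
    have hi := isInducing_O q
    refine continuous_pi fun o => (hi.comp Topology.IsInducing.subtypeVal).continuous_iff.2 ?_
    let e := D.productMulEquiv K N hK hN hKN hc
    have h : ∀ g : N, (((e.symm g o : q.O) : V ≃ₗ[F] V) : Module.End F V) =
        (((g : q.O) : V ≃ₗ[F] V) : Module.End F V) * (D.blockProj o : Module.End F V) +
          (1 - D.blockProj o) := by
      intro g
      have hg : Subgroup.noncommPiCoprod (D.pairwise_commute K hK) (e.symm g) = g :=
        congrArg Subtype.val (e.apply_symm_apply g)
      refine D.ext_block fun p x hx => ?_
      change _ = D.componentMap ((g : q.O) : V ≃ₗ[F] V) o x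
      rcases eq_or_ne p o with rfl | hp
      · rw [D.componentMap_self _ hx, LinearEquiv.coe_coe, LinearEquiv.coe_coe,
          ← D.prod_apply K hK (e.symm g) p hx, hg]
      · rw [D.componentMap_of_ne _ hp hx]
        exact (hK o (e.symm g o).2).2 p hp x hx
    refine (continuous_congr h).2 ?_
    exact ((hi.continuous.comp continuous_subtype_val).mul continuous_const).add continuous_const

/-- The identification `∏ᵢ GL(ℓᵢ) × O(V♭)(F) ≃ M⁺(F)` of topological groups, given by
multiplication in `O(V)(F)`. -/
noncomputable def prodEquivLeviO : (∀ o, D.factorO o) ≃ₜ* D.leviO :=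
  D.productEquiv D.factorO D.leviO (fun _ => le_rfl) le_rfl D.factorO_le
    fun _ _ _ _ hc _ => hc

/-- The identification `∏ᵢ GL(ℓᵢ) × SO(V♭)(F) ≃ M(F)` of topological groups, given by
multiplication in `O(V)(F)`. -/
noncomputable def prodEquivLeviSO : (∀ o, D.factorSO o) ≃ₜ* D.leviSO :=
  D.productEquiv D.factorSO D.leviSO D.factorSO_le inf_le_left D.factorSO_le_leviSO
    fun _ hg _ _ hc hcg => D.mem_factorSO_of_eq hg hc hcg

variable {A : Type*} [CommGroup A] [TopologicalSpace A] [Finite A] [DiscreteTopology A]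

/-- Given a topological central extension `E` of `O(V)(F)`, the preimage of `M⁺(F)` is decomposed:
as a topological central extension of `M⁺(F) = ∏ᵢ GL(ℓᵢ) × O(V♭)(F)`, it is isomorphic to the
external Baer sum of the preimages of the factors. -/
def IsDecomposedO (E : TopCExt A q.O) : Prop :=
  Nonempty (TopCExt.Iso (E.restrict D.leviO)
    ((TopCExt.externalBaerSum fun o => E.restrict (D.factorO o)).congr D.prodEquivLeviO))

/-- Given a topological central extension `E` of `O(V)(F)`, the preimage of `M(F)` is decomposed:
as a topological central extension of `M(F) = ∏ᵢ GL(ℓᵢ) × SO(V♭)(F)`, it is isomorphic to the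
external Baer sum of the preimages of the factors. -/
def IsDecomposedSO (E : TopCExt A q.O) : Prop :=
  Nonempty (TopCExt.Iso (E.restrict D.leviSO)
    ((TopCExt.externalBaerSum fun o => E.restrict (D.factorSO o)).congr D.prodEquivLeviSO))

end

end LeviDatum

end QuadSpace

/-!
Decomposedness is a commutation property.  If a subgroup `N` is the internal direct product of
pairwise commuting subgroups `K i`, then the preimage of `N` in a central extension is the external
Baer sum of the preimages of the `K i` if and only if the preimages of different `K i` commute with
one another (`TopCExt.nonempty_iso_externalBaerSum_iff`).  In the Baer sum two elements commute when
in each coordinate one of them lies over `1`.  Conversely, when the preimages commute,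
multiplication defines a continuous homomorphism from the Baer sum to the preimage of `N`, and the
short five lemma for central extensions (`TopCExt.nonempty_iso_of_hom`) makes it an isomorphism of
topological groups.

Applied to `M⁺(F)` and `M(F)`, this makes one direction immediate and leaves, for the other, the
commutation of the preimages of `GL(ℓᵢ)` and `O(V♭)(F)`.  If the preimage of `M(F)` is decomposed,
the preimages of `GL(ℓᵢ)` and `SO(V♭)(F)` commute.  Since `SO(V♭)(F)` has index two in `O(V♭)(F)`,
with `τ` representing the other coset, it is then enough that `g ↦ comm(g, τ)` is trivial on
`GL(ℓᵢ)`.  This is a homomorphism to a commutative group, so it takes the same value on conjugate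
elements and is trivial on transvections, because `2 ≠ 0` in `F`; and `GL(ℓᵢ)` is generated by
transvections and its diagonal torus, where triviality is assumed
(`QuadSpace.LeviDatum.eq_one_of_forall_diagonalTorus`).
-/

/-! ### Decomposed central extensions -/

namespace TopCExt

variable {A : Type*} [CommGroup A] [TopologicalSpace A]

section

variable {H : Type*} [Group H] [TopologicalSpace H]

/-- The inverse of an isomorphism of topological central extensions. -/
def Iso.symm {E E' : TopCExt A H} (e : Iso E E') : Iso E' E where
  toEquiv := e.toEquiv.symm
  map_inl a := by rw [← e.map_inl a]; exact e.toEquiv.symm_apply_apply _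
  proj_map x := by
    have h := e.proj_map (e.toEquiv.symm x)
    rwa [show e.toEquiv (e.toEquiv.symm x) = x from e.toEquiv.apply_symm_apply x, eq_comm] at h

/-- An element of the extension lying over `1` is central. -/
theorem commute_of_proj_eq_one (E : TopCExt A H) {x : E.carrier} (hx : E.proj x = 1)
    (y : E.carrier) : Commute x y := by
  obtain ⟨a, rfl⟩ := E.exists_inl_eq hx
  exact E.central a y

theorem commute_iff_comm_eq_one (E : TopCExt A H) {h₁ h₂ : H} (h : Commute h₁ h₂) {x y : E.carrier}
    (hx : E.proj x = h₁) (hy : E.proj y = h₂) : Commute x y ↔ E.comm h₁ h₂ h = 1 := by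
  rw [← E.isSES.isClosedEmbedding.injective.eq_iff, E.inl_comm h x y hx hy, map_one,
    mul_inv_eq_one, mul_inv_eq_iff_eq_mul]
  rfl

/-- The short five lemma: a continuous homomorphism of topological central extensions by a discrete
group that induces the identity on the kernel and on the base is an isomorphism of topological
groups. -/
theorem nonempty_iso_of_hom [DiscreteTopology A] {E E' : TopCExt A H} (f : E.carrier →* E'.carrier)
    (hf : Continuous f) (hinl : ∀ a, f (E.inl a) = E'.inl a)
    (hproj : ∀ x, E'.proj (f x) = E.proj x) : Nonempty (Iso E E') := by
  have hbij : Function.Bijective f := by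
    constructor
    · refine (injective_iff_map_eq_one f).2 fun x hx => ?_
      obtain ⟨a, rfl⟩ := E.exists_inl_eq (x := x) (by rw [← hproj, hx, map_one])
      rw [hinl, ← map_one E'.inl] at hx
      rw [E'.isSES.isClosedEmbedding.injective hx, map_one]
    · intro y
      obtain ⟨x, hx⟩ := E.isSES.isOpenQuotientMap.surjective (E'.proj y)
      obtain ⟨a, ha⟩ := E'.exists_inl_eq (x := y * (f x)⁻¹) (by simp [hproj, hx])
      exact ⟨E.inl a * x, by rw [map_mul, hinl, ha]; group⟩
  let e : E.carrier ≃* E'.carrier := MulEquiv.ofBijective f hbij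
  have he : ∀ x, e.symm (f x) = x := e.symm_apply_apply
  refine ⟨{ toEquiv := { e with continuous_toFun := hf, continuous_invFun := ?_ }
            map_inl := hinl
            proj_map := hproj }⟩
  change Continuous e.symm
  refine continuous_of_continuousAt_one e.symm fun U hU => ?_
  rw [map_one] at hU
  -- Near `1` the image of `A` is trivial, so there an element is determined by its projection.
  obtain ⟨W, hW, hWA⟩ : ∃ W ∈ nhds (1 : E'.carrier), ∀ a, E'.inl a ∈ W → a = 1 := by
    have h : ({1} : Set A) ∈ nhds (1 : A) := by simp
    rw [E'.isSES.isClosedEmbedding.isInducing.nhds_eq_comap, map_one] at h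
    obtain ⟨W, hW, h⟩ := h
    exact ⟨W, hW, fun a ha => h ha⟩
  obtain ⟨V, hV, hVW⟩ := exists_nhds_split_inv hW
  have hT : U ∩ f ⁻¹' V ∈ nhds (1 : E.carrier) :=
    Filter.inter_mem hU (hf.continuousAt.preimage_mem_nhds (by rwa [map_one]))
  have hT' : E'.proj ⁻¹' (E.proj '' (U ∩ f ⁻¹' V)) ∈ nhds (1 : E'.carrier) := by
    refine E'.isSES.isOpenQuotientMap.continuous.continuousAt.preimage_mem_nhds ?_
    rw [map_one, ← map_one E.proj]
    exact E.isSES.isOpenQuotientMap.isOpenMap.image_mem_nhds hT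
  refine Filter.mem_map.2 (Filter.mem_of_superset (Filter.inter_mem hV hT') ?_)
  rintro y ⟨hyV, x, ⟨hxU, hxV⟩, hxy⟩
  obtain ⟨a, ha⟩ := E'.exists_inl_eq (x := y / f x) (by simp [hproj, hxy])
  have ha1 : a = 1 := hWA a (ha ▸ hVW y hyV _ hxV)
  rw [ha1, map_one, eq_comm, div_eq_one] at ha
  rw [Set.mem_preimage, ha, he]
  exact hxU

end

section

variable [Finite A] [DiscreteTopology A] {ι : Type*} [Fintype ι]

/-- Coordinatewise, one of the two elements comes from the center. -/
theorem commute_externalBaerSum {H : ι → Type*} [∀ i, Group (H i)] [∀ i, TopologicalSpace (H i)]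
    (E : ∀ i, TopCExt A (H i)) {x y : (externalBaerSum E).carrier}
    (h : ∀ i, (externalBaerSum E).proj x i = 1 ∨ (externalBaerSum E).proj y i = 1) :
    Commute x y := by
  obtain ⟨⟨a, x⟩, rfl⟩ := QuotientGroup.mk_surjective x
  obtain ⟨⟨b, y⟩, rfl⟩ := QuotientGroup.mk_surjective y
  have key : Commute (a, x) (b, y) := by
    refine Prod.ext (mul_comm a b) (funext fun i => ?_)
    rcases h i with hi | hi
    · exact (E i).commute_of_proj_eq_one hi _
    · exact ((E i).commute_of_proj_eq_one hi _).symm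
  exact key.map (QuotientGroup.mk' (antidiagonal E).range)

theorem continuous_noncommPiCoprod {G : Type*} [Group G] [TopologicalSpace G] [ContinuousMul G]
    {K : ι → Subgroup G}
    (hK : Pairwise fun i j => ∀ x y : G, x ∈ K i → y ∈ K j → Commute x y) :
    Continuous (Subgroup.noncommPiCoprod hK) := by
  classical
  have h : ∀ s : Finset ι, Continuous fun k : ∀ i, K i =>
      s.noncommProd (fun i => (k i : G)) fun i _ j _ hij => hK hij _ _ (k i).2 (k j).2 := by
    intro s
    induction s using Finset.induction_on with
    | empty => exact continuous_const (y := (1 : G))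
    | insert i s hi ih =>
      exact ((continuous_subtype_val.comp (continuous_apply i)).mul ih).congr fun k =>
        (Finset.noncommProd_insert_of_notMem s i (fun i => (k i : G)) _ hi).symm
  exact (h Finset.univ).congr fun k => (Subgroup.noncommPiCoprod_apply hK k).symm

/-- Let `N` be the internal direct product of commuting subgroups `K i`.  The preimage of `N` is the
external Baer sum of the preimages of the `K i` if and only if the preimages of the `K i` commute
with one another. -/
theorem nonempty_iso_externalBaerSum_iff {G : Type*} [Group G] [TopologicalSpace G]
    (E : TopCExt A G) {K : ι → Subgroup G} {N : Subgroup G}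
    (hK : Pairwise fun i j => ∀ x y : G, x ∈ K i → y ∈ K j → Commute x y)
    (φ : (∀ i, K i) ≃ₜ* N) (hφ : ∀ k, (φ k : G) = Subgroup.noncommPiCoprod hK k) :
    Nonempty (Iso (E.restrict N) ((externalBaerSum fun i => E.restrict (K i)).congr φ)) ↔
      Pairwise fun i j => ∀ x y : E.carrier,
        x ∈ (K i).comap E.proj → y ∈ (K j).comap E.proj → Commute x y := by
  classical
  constructor
  · rintro ⟨e⟩ i j hij x y hx hy
    have hsingle : ∀ i (k : K i), (φ (Pi.mulSingle i k) : G) = k := fun i k => by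
      rw [hφ, Subgroup.noncommPiCoprod_mulSingle]
    have hN : ∀ i (x : E.carrier), x ∈ (K i).comap E.proj → x ∈ N.comap E.proj :=
      fun i x hx => by
        have h := (φ (Pi.mulSingle i ⟨E.proj x, hx⟩)).2
        rwa [hsingle] at h
    have hproj : ∀ i (x : E.carrier) (hx : x ∈ (K i).comap E.proj),
        (externalBaerSum fun i => E.restrict (K i)).proj (e.toEquiv ⟨x, hN i x hx⟩) =
          Pi.mulSingle i ⟨E.proj x, hx⟩ := fun i x hx =>
      φ.injective <| (e.proj_map ⟨x, hN i x hx⟩).trans (Subtype.ext (hsingle i ⟨_, hx⟩).symm)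
    have hc := commute_externalBaerSum (fun i => E.restrict (K i))
      (x := e.toEquiv ⟨x, hN i x hx⟩) (y := e.toEquiv ⟨y, hN j y hy⟩) fun p => by
        rw [hproj i x hx, hproj j y hy]
        rcases eq_or_ne p i with rfl | hp
        · exact .inr (Pi.mulSingle_eq_of_ne hij _)
        · exact .inl (Pi.mulSingle_eq_of_ne hp _)
    have hc' : Commute (⟨x, hN i x hx⟩ : (E.restrict N).carrier) ⟨y, hN j y hy⟩ :=
      e.toEquiv.injective <|
        (map_mul e.toEquiv _ _).trans (hc.eq.trans (map_mul e.toEquiv _ _).symm)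
    exact congrArg Subtype.val hc'.eq
  · intro h
    -- Multiplication of the commuting preimages descends from `A × ∏ Eᵢ` to the Baer sum.
    let μ : (∀ i, (E.restrict (K i)).carrier) →* E.carrier := Subgroup.noncommPiCoprod h
    have hμproj : ∀ x, E.proj (μ x) = φ fun i => (E.restrict (K i)).proj (x i) := fun x =>
      by
      rw [hφ]
      exact Finset.map_noncommProd Finset.univ (fun i => (x i).1)
        (fun i _ j _ hij => h hij _ _ (x i).2 (x j).2) E.proj
    have hμinl : ∀ z : ι → A,
        μ (fun i => (E.restrict (K i)).inl (z i)) = E.inl (∏ i, z i) := fun z => by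
      rw [← Finset.noncommProd_eq_prod]
      exact (Finset.map_noncommProd _ _ _ E.inl).symm
    let f : A × (∀ i, (E.restrict (K i)).carrier) →* E.carrier :=
      E.inl.noncommCoprod μ fun a x => E.central a _
    have hf : ∀ p, f p = E.inl p.1 * μ p.2 := fun _ => rfl
    have hfN : ∀ p, f p ∈ N.comap E.proj := fun p => by
      rw [Subgroup.mem_comap, hf, map_mul, E.proj_inl, one_mul, hμproj]
      exact (φ _).2
    have hfc : Continuous f :=
      (E.isSES.isClosedEmbedding.continuous.comp continuous_fst).mul
        ((continuous_noncommPiCoprod h).comp continuous_snd)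
    let g := QuotientGroup.lift (antidiagonal fun i => E.restrict (K i)).range
      (f.codRestrict _ hfN) (by
        rintro _ ⟨z, rfl⟩
        refine Subtype.ext ((hf _).trans ?_)
        change E.inl (∏ i, z i)⁻¹ * μ (fun i => (E.restrict (K i)).inl (z i)) = 1
        rw [hμinl, ← map_mul, inv_mul_cancel, map_one])
    refine (nonempty_iso_of_hom
      (E := (externalBaerSum fun i => E.restrict (K i)).congr φ) (E' := E.restrict N)
      g ?_ ?_ ?_).map Iso.symm
    · exact continuous_quot_lift _ (hfc.subtype_mk _)
    · intro a
      refine Subtype.ext ((hf (a, 1)).trans ?_)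
      rw [map_one, mul_one]
      rfl
    · intro x
      obtain ⟨⟨a, x⟩, rfl⟩ := QuotientGroup.mk_surjective x
      refine Subtype.ext ?_
      change E.proj (f (a, x)) = _
      rw [hf, map_mul, E.proj_inl, one_mul, hμproj]
      rfl

end

end TopCExt

/-- For a subgroup `K` centralizing `h`, the homomorphism `k ↦ comm(k, h)` from `K` to `A`. -/
noncomputable def TopCExt.commHom {A H : Type*} [CommGroup A] [TopologicalSpace A] [Group H]
    [TopologicalSpace H] (E : TopCExt A H) (K : Subgroup H) (h : H)
    (hK : ∀ k ∈ K, Commute k h) : K →* A :=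
  MonoidHom.mk' (fun k => E.comm k h (hK k k.2)) fun k l => by
    obtain ⟨x, hx⟩ := E.isSES.isOpenQuotientMap.surjective (k : H)
    obtain ⟨y, hy⟩ := E.isSES.isOpenQuotientMap.surjective (l : H)
    obtain ⟨z, hz⟩ := E.isSES.isOpenQuotientMap.surjective h
    refine E.isSES.isClosedEmbedding.injective ?_
    rw [E.inl_comm (hK _ (k * l).2) (x * y) z (by rw [map_mul, hx, hy, Subgroup.coe_mul]) hz,
      mul_comm, map_mul, E.inl_comm (hK k k.2) x z hx hz]
    calc x * y * z * (x * y)⁻¹ * z⁻¹ = x * (y * z * y⁻¹ * z⁻¹) * (z * x⁻¹ * z⁻¹) := by group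
      _ = _ := by
        rw [← E.inl_comm (hK l l.2) y z hy hz, ← E.central]
        group

/-! ### Characters of the general linear group -/

/-- Outside characteristic `2`, a homomorphism from `GL n F` to a commutative group is trivial as
soon as it is trivial on diagonal matrices: conjugation by a diagonal matrix with one entry `-1`
turns the transvection `t c` with parameter `c` into `t (-c) = (t c)⁻¹`, so that the homomorphism
takes the value `1` at `t c * t c = t (2 * c)`. -/
theorem Matrix.GeneralLinearGroup.eq_one_of_forall_diagonal {n F A : Type*} [Fintype n]
    [DecidableEq n] [Field F] [CommGroup A] (h2 : (2 : F) ≠ 0) (χ : GL n F →* A)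
    (hχ : ∀ (g : GL n F) (d : n → F), (g : Matrix n n F) = Matrix.diagonal d → χ g = 1)
    (g : GL n F) : χ g = 1 := by
  refine Matrix.diagonal_transvection_induction_of_det_ne_zero
    (fun M => ∀ g : GL n F, (g : Matrix n n F) = M → χ g = 1) g
    ((Matrix.isUnit_iff_isUnit_det _).1 g.isUnit).ne_zero
    (fun d _ g hg => hχ g d hg) ?_ ?_ g rfl
  · rintro ⟨i, j, hij, c⟩ g hg
    have htdet : ∀ c : F, (Matrix.transvection i j c).det ≠ 0 := fun c => by
      rw [Matrix.det_transvection_of_ne i j hij]; exact one_ne_zero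
    let t : F → GL n F := fun c => Matrix.GeneralLinearGroup.mkOfDetNeZero _ (htdet c)
    let e : n → F := Function.update 1 i (-1)
    have he : (Matrix.diagonal e).det ≠ 0 := by
      rw [Matrix.det_diagonal, Finset.prod_ne_zero_iff]
      intro k _
      rcases eq_or_ne k i with rfl | hk
      · simp [e]
      · simp [e, hk]
    let d : GL n F := Matrix.GeneralLinearGroup.mkOfDetNeZero _ he
    have hconj : ∀ c, d * t c = t (-c) * d := fun c => by
      refine Units.ext ?_
      change Matrix.diagonal e * Matrix.transvection i j c =
        Matrix.transvection i j (-c) * Matrix.diagonal e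
      simp only [Matrix.transvection, mul_add, add_mul, mul_one, one_mul]
      congr 1
      ext k l
      rw [Matrix.diagonal_mul, Matrix.mul_diagonal, Matrix.single_apply, Matrix.single_apply]
      split_ifs with h
      · obtain ⟨rfl, rfl⟩ := h
        simp [e, hij.symm]
      · simp
    have hadd : ∀ c c', t (c + c') = t c * t c' := fun c c' => by
      refine Units.ext ?_
      exact (Matrix.transvection_mul_transvection_same i j hij c c').symm
    have hneg : ∀ c, χ (t c) = χ (t (-c)) := fun c => by
      have := congrArg χ (hconj c)
      rw [map_mul, map_mul, mul_comm] at this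
      exact mul_right_cancel this
    have hgt : g = t (c / 2 + c / 2) := Units.ext <| by
      have : NeZero (2 : F) := ⟨h2⟩
      rw [hg, add_halves]
      rfl
    have h0 : t 0 = 1 := Units.ext (Matrix.transvection_zero i j)
    rw [hgt, hadd, map_mul]
    nth_rw 2 [hneg]
    rw [← map_mul, ← hadd, add_neg_cancel, h0, map_one]
  · intro M N hM hN ihM ihN g hg
    rw [show g = Matrix.GeneralLinearGroup.mkOfDetNeZero M hM *
      Matrix.GeneralLinearGroup.mkOfDetNeZero N hN from Units.ext hg, map_mul,
      ihM _ rfl, ihN _ rfl, mul_one]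

/-- The coordinate-free form of `Matrix.GeneralLinearGroup.eq_one_of_forall_diagonal`. -/
theorem LinearEquiv.eq_one_of_forall_diagonal {n F W A : Type*} [Fintype n] [Field F]
    [AddCommGroup W] [Module F W] [CommGroup A] (h2 : (2 : F) ≠ 0) (b : Module.Basis n F W)
    (χ : (W ≃ₗ[F] W) →* A)
    (hχ : ∀ g : W ≃ₗ[F] W, (∀ k, ∃ a : F, g (b k) = a • b k) → χ g = 1) (g : W ≃ₗ[F] W) :
    χ g = 1 := by
  classical
  let e : GL n F ≃* (W ≃ₗ[F] W) :=
    (Units.mapEquiv (Matrix.toLinAlgEquiv b).toMulEquiv).trans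
      (LinearMap.GeneralLinearGroup.generalLinearEquiv F W)
  have he : ∀ (M : GL n F) (k : n), e M (b k) = ∑ j, (M : Matrix n n F) j k • b j := fun M k =>
    Matrix.toLinAlgEquiv_self b M k
  rw [← e.apply_symm_apply g]
  refine Matrix.GeneralLinearGroup.eq_one_of_forall_diagonal h2 (χ.comp e.toMonoidHom)
    (fun M d hM => hχ (e M) fun k => ⟨d k, ?_⟩) (e.symm g)
  rw [he, hM, Finset.sum_eq_single k]
  · rw [Matrix.diagonal_apply_eq]
  · intro j _ hj
    rw [Matrix.diagonal_apply_ne _ hj, zero_smul]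
  · simp

/-! ### The index of the special orthogonal group -/

namespace QuadSpace

variable {F V : Type*} [Field F] [AddCommGroup V] [Module F V] {q : QuadSpace F V}

theorem det_mul_self_of_mem_O [FiniteDimensional F V] (g : q.O) :
    LinearMap.det ((g : V ≃ₗ[F] V) : V →ₗ[F] V) *
      LinearMap.det ((g : V ≃ₗ[F] V) : V →ₗ[F] V) = 1 := by
  let b := Module.finBasis F V
  have hform : q.form.comp (g : V ≃ₗ[F] V) (g : V ≃ₗ[F] V) = q.form :=
    LinearMap.ext₂ fun x y => g.2 x y
  have h := congrArg (fun B => (LinearMap.BilinForm.toMatrix b B).det) hform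
  simp only [LinearMap.BilinForm.toMatrix_comp b b, Matrix.det_mul, Matrix.det_transpose,
    LinearMap.det_toMatrix] at h
  have hJ := (LinearMap.BilinForm.nondegenerate_iff_det_ne_zero b).1 q.nondegenerate
  refine mul_right_cancel₀ hJ ?_
  linear_combination h

theorem mem_SO_iff (g : q.O) :
    g ∈ q.SO ↔ LinearMap.det ((g : V ≃ₗ[F] V) : V →ₗ[F] V) = 1 := by
  rw [SO, MonoidHom.mem_ker, ← Units.val_inj]
  simp

/-- `SO(V)` has index at most `2` in `O(V)`. -/
theorem inv_mul_mem_SO [FiniteDimensional F V] {g h : q.O} (hg : g ∉ q.SO) (hh : h ∉ q.SO) :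
    g⁻¹ * h ∈ q.SO := by
  have hdet : ∀ g : q.O, g ∉ q.SO → LinearMap.det ((g : V ≃ₗ[F] V) : V →ₗ[F] V) = -1 :=
    fun g hg => (mul_self_eq_one_iff.1 (det_mul_self_of_mem_O g)).resolve_left
      (mt (mem_SO_iff g).2 hg)
  have hgh : g * (g⁻¹ * h) = h := by group
  have h1 := hdet h hh
  rw [← hgh, show (((g * (g⁻¹ * h) : q.O) : V ≃ₗ[F] V) : V →ₗ[F] V) =
    ((g : V ≃ₗ[F] V) : V →ₗ[F] V) ∘ₗ (((g⁻¹ * h : q.O) : V ≃ₗ[F] V) : V →ₗ[F] V) from rfl,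
    LinearMap.det_comp, hdet g hg] at h1
  exact (mem_SO_iff _).2 (by linear_combination -h1)

namespace LeviDatum

variable (D : q.LeviDatum)

/-! ### The factors `GL(ℓᵢ)` -/

/-- The automorphism of `V` that acts by `f s` on each summand `D.piece s`. -/
noncomputable def ofPieces (f : ∀ s, D.piece s ≃ₗ[F] D.piece s) : V ≃ₗ[F] V :=
  (LinearEquiv.ofBijective (DirectSum.coeLinearMap D.piece) D.isInternal).symm ≪≫ₗ
    DFinsupp.mapRange.linearEquiv f ≪≫ₗ
    LinearEquiv.ofBijective (DirectSum.coeLinearMap D.piece) D.isInternal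

theorem ofPieces_apply (f : ∀ s, D.piece s ≃ₗ[F] D.piece s) {s} {x : V} (hx : x ∈ D.piece s) :
    D.ofPieces f x = f s ⟨x, hx⟩ := by
  let e := LinearEquiv.ofBijective (DirectSum.coeLinearMap D.piece) D.isInternal
  have he : ∀ y : D.piece s, e (DirectSum.lof F _ (fun s => D.piece s) s y) = y := fun y =>
    DirectSum.coeLinearMap_lof D.piece s y
  have hsymm : e.symm x = DirectSum.lof F _ (fun s => D.piece s) s ⟨x, hx⟩ := by
    rw [LinearEquiv.symm_apply_eq, he]
  change e (DFinsupp.mapRange.linearEquiv f (e.symm x)) = _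
  rw [hsymm, ← he]
  exact congrArg e (DFinsupp.mapRange_single (hf := fun s => map_zero (f s)))

theorem ofPieces_mem_iff (f : ∀ s, D.piece s ≃ₗ[F] D.piece s) {s} {x : V} :
    D.ofPieces f x ∈ D.piece s ↔ x ∈ D.piece s := by
  constructor
  · intro h
    have h' : D.ofPieces f ((f s).symm ⟨_, h⟩) = D.ofPieces f x := by
      rw [D.ofPieces_apply f ((f s).symm ⟨_, h⟩).2, Subtype.coe_eta, LinearEquiv.apply_symm_apply]
    rw [← (D.ofPieces f).injective h']
    exact Subtype.coe_prop _
  · intro h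
    rw [D.ofPieces_apply f h]
    exact Subtype.coe_prop _

/-- The pairing of `ℓᵢ` and `ℓᵢ'` given by the form. -/
def pairing (i : Fin D.r) : D.ℓ i →ₗ[F] D.ℓ' i →ₗ[F] F :=
  q.form.domRestrict₁₂ (D.ℓ i) (D.ℓ' i)

variable [FiniteDimensional F V]

/-- Non-degeneracy on `ℓᵢ ⊕ ℓᵢ'` passes to the pairing because `ℓᵢ` and `ℓᵢ'` are isotropic. -/
theorem pairing_isPerfPair (i : Fin D.r) : (D.pairing i).IsPerfPair := by
  have key : ∀ z (hz : z ∈ D.ℓ i ⊔ D.ℓ' i),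
      (∀ x ∈ D.ℓ i, q.form z x = 0) → (∀ y ∈ D.ℓ' i, q.form z y = 0) → z = 0 := by
    intro z hz h h'
    refine congrArg Subtype.val ((D.nondegenerate i).1 ⟨z, hz⟩ fun w => ?_)
    obtain ⟨w, hw⟩ := w
    obtain ⟨x, hx, y, hy, rfl⟩ := Submodule.mem_sup.1 hw
    change q.form z (x + y) = 0
    rw [map_add, h x hx, h' y hy, add_zero]
  refine .of_injective ((injective_iff_map_eq_zero _).2 fun x hx => ?_)
    ((injective_iff_map_eq_zero _).2 fun y hy => ?_)
  · exact Subtype.ext (key x (Submodule.mem_sup_left x.2) (D.isotropic i x x.2)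
      fun y hy => LinearMap.congr_fun hx ⟨y, hy⟩)
  · refine Subtype.ext (key y (Submodule.mem_sup_right y.2) (fun x hx => ?_) (D.isotropic' i y y.2))
    rw [← q.symm.eq]
    exact LinearMap.congr_fun hy ⟨x, hx⟩

/-- The contragredient of an automorphism `a` of `ℓᵢ`: the automorphism of `ℓᵢ'` corresponding to
the inverse of the transpose of `a` under the identification of `ℓᵢ'` with the dual of `ℓᵢ`. -/
noncomputable def contragredient (i : Fin D.r) (a : D.ℓ i ≃ₗ[F] D.ℓ i) : D.ℓ' i ≃ₗ[F] D.ℓ' i :=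
  haveI := D.pairing_isPerfPair i
  (D.pairing i).flip.toPerfPair ≪≫ₗ a.symm.dualMap ≪≫ₗ (D.pairing i).flip.toPerfPair.symm

theorem form_contragredient (i : Fin D.r) (a : D.ℓ i ≃ₗ[F] D.ℓ i) (x : D.ℓ i) (y : D.ℓ' i) :
    q.form (a x) (D.contragredient i a y) = q.form x y := by
  have := D.pairing_isPerfPair i
  have h := (D.pairing i).apply_toPerfPair_flip
    (a.symm.dualMap ((D.pairing i).flip.toPerfPair y)) (a x)
  refine h.trans ?_
  rw [LinearEquiv.dualMap_apply, LinearEquiv.symm_apply_apply]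
  rfl

theorem eq_of_forall_form_eq (i : Fin D.r) {y y' : V} (hy : y ∈ D.ℓ' i) (hy' : y' ∈ D.ℓ' i)
    (h : ∀ x ∈ D.ℓ i, q.form x y = q.form x y') : y = y' := by
  have := D.pairing_isPerfPair i
  refine congrArg Subtype.val ((D.pairing i).flip.toPerfPair.injective (a₁ := ⟨y, hy⟩)
    (a₂ := ⟨y', hy'⟩) (LinearMap.ext fun x => h x x.2))

/-- Every automorphism of `ℓᵢ` extends to an element of the corresponding factor of `M⁺(F)`, by the
contragredient on `ℓᵢ'`. -/
theorem exists_mem_factorO (i : Fin D.r) (a : D.ℓ i ≃ₗ[F] D.ℓ i) :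
    ∃ g ∈ D.factorO (some i), ∀ x : D.ℓ i, (g : V ≃ₗ[F] V) x = a x := by
  let a₁ : D.piece (.inl (.inl i)) ≃ₗ[F] D.piece (.inl (.inl i)) := a
  let a₂ : D.piece (.inl (.inr i)) ≃ₗ[F] D.piece (.inl (.inr i)) := D.contragredient i a
  let f : ∀ s, D.piece s ≃ₗ[F] D.piece s :=
    Function.update (Function.update (fun s => LinearEquiv.refl F (D.piece s)) _ a₁) _ a₂
  let e := D.ofPieces f
  have hl : ∀ x : D.ℓ i, e x = a x := fun x => by
    refine (D.ofPieces_apply f (s := .inl (.inl i)) x.2).trans ?_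
    rw [show f (.inl (.inl i)) = a₁ from
      (Function.update_of_ne (by simp) _ _).trans (Function.update_self _ _ _)]
    rfl
  have hl' : ∀ y : D.ℓ' i, e y = D.contragredient i a y := fun y => by
    refine (D.ofPieces_apply f (s := .inl (.inr i)) y.2).trans ?_
    rw [show f (.inl (.inr i)) = a₂ from Function.update_self _ _ _]
    rfl
  have hpiece : ∀ s, s ≠ .inl (.inl i) → s ≠ .inl (.inr i) → ∀ x ∈ D.piece s, e x = x := by
    intro s h h' x hx
    rw [D.ofPieces_apply f hx, show f s = LinearEquiv.refl F _ from
      (Function.update_of_ne h' _ _).trans (Function.update_of_ne h _ _)]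
    rfl
  have hfix : ∀ o, o ≠ some i → ∀ x ∈ D.block o, e x = x := by
    rintro (_ | j) ho x hx
    · exact hpiece (.inr ()) (by simp) (by simp) x hx
    · have hj : j ≠ i := fun h => ho (congrArg some h)
      obtain ⟨y, hy, z, hz, rfl⟩ := Submodule.mem_sup.1 hx
      rw [map_add, hpiece (.inl (.inl j)) (by simpa using hj) (by simp) y hy,
        hpiece (.inl (.inr j)) (by simp) (by simpa using hj) z hz]
  have hblock : ∀ o, ∀ x ∈ D.block o, e x ∈ D.block o := by
    intro o x hx
    rcases eq_or_ne o (some i) with rfl | ho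
    · obtain ⟨y, hy, z, hz, rfl⟩ := Submodule.mem_sup.1 hx
      rw [map_add, hl ⟨y, hy⟩, hl' ⟨z, hz⟩]
      exact Submodule.add_mem_sup (a _).2 (D.contragredient i a _).2
    · rwa [hfix o ho x hx]
  have hform : q.form.compl₁₂ (e : V →ₗ[F] V) (e : V →ₗ[F] V) = q.form := by
    refine D.form_ext_block fun o x hx o' y hy => ?_
    simp only [LinearMap.compl₁₂_apply, LinearEquiv.coe_coe]
    rcases eq_or_ne o o' with rfl | hoo
    · rcases eq_or_ne o (some i) with rfl | ho
      · obtain ⟨x, hxl, x', hx', rfl⟩ := Submodule.mem_sup.1 hx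
        obtain ⟨y, hyl, y', hy', rfl⟩ := Submodule.mem_sup.1 hy
        have h1 := D.form_contragredient i a ⟨x, hxl⟩ ⟨y', hy'⟩
        have h2 := D.form_contragredient i a ⟨y, hyl⟩ ⟨x', hx'⟩
        rw [← q.symm.eq, ← q.symm.eq x' y] at h2
        simp only [map_add, LinearMap.add_apply]
        rw [hl ⟨x, hxl⟩, hl ⟨y, hyl⟩, hl' ⟨x', hx'⟩, hl' ⟨y', hy'⟩, h1, h2,
          D.isotropic i _ (a _).2 _ (a _).2, D.isotropic i x hxl y hyl,
          D.isotropic' i _ (D.contragredient i a _).2 _ (D.contragredient i a _).2,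
          D.isotropic' i x' hx' y' hy']
      · rw [hfix o ho x hx, hfix o ho y hy]
    · rw [D.form_eq_zero hoo (hblock o x hx) (hblock o' y hy), D.form_eq_zero hoo hx hy]
  exact ⟨⟨e, fun x y => LinearMap.congr_fun₂ hform x y⟩,
    ⟨fun s x => D.ofPieces_mem_iff f, hfix⟩, hl⟩

/-- An element of the factor `GL(ℓᵢ)` of `M⁺(F)` is determined by its restriction to `ℓᵢ`. -/
theorem ext_factorO {i : Fin D.r} {g h : q.O} (hg : g ∈ D.factorO (some i))
    (hh : h ∈ D.factorO (some i))
    (hgh : ∀ x ∈ D.ℓ i, (g : V ≃ₗ[F] V) x = (h : V ≃ₗ[F] V) x) : g = h := by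
  refine D.ext_O fun o x hx => ?_
  rcases eq_or_ne o (some i) with rfl | ho
  · obtain ⟨x, hxl, y, hy, rfl⟩ := Submodule.mem_sup.1 hx
    rw [map_add, map_add, hgh x hxl]
    congr 1
    refine D.eq_of_forall_form_eq i ((hg.1 (.inl (.inr i)) y).2 hy)
      ((hh.1 (.inl (.inr i)) y).2 hy) fun z hz => ?_
    obtain ⟨w, rfl⟩ := (g : V ≃ₗ[F] V).surjective z
    have hw : w ∈ D.ℓ i := (hg.1 (.inl (.inl i)) w).1 hz
    rw [g.2, hgh w hw, h.2]
  · rw [hg.2 o ho x hx, hh.2 o ho x hx]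

/-- The identification of the factor of `M⁺(F)` at `i` with `GL(ℓᵢ)`, by restriction to `ℓᵢ`. -/
noncomputable def factorOEquiv (i : Fin D.r) : D.factorO (some i) ≃* (D.ℓ i ≃ₗ[F] D.ℓ i) :=
  MulEquiv.ofBijective
    (MonoidHom.mk' (fun g : D.factorO (some i) =>
      ((g : q.O) : V ≃ₗ[F] V).ofSubmodules (D.ℓ i) (D.ℓ i) (by
      refine le_antisymm ?_ fun x hx => ?_
      · rintro _ ⟨x, hx, rfl⟩
        exact (g.2.1 (.inl (.inl i)) x).2 hx
      · obtain ⟨y, rfl⟩ := ((g : q.O) : V ≃ₗ[F] V).surjective x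
        exact ⟨y, (g.2.1 (.inl (.inl i)) y).1 hx, rfl⟩)) fun g h => rfl) <| by
    constructor
    · intro g h hgh
      exact Subtype.ext (D.ext_factorO g.2 h.2 fun x hx =>
        congrArg Subtype.val (LinearEquiv.congr_fun hgh ⟨x, hx⟩))
    · intro a
      obtain ⟨g, hg, hga⟩ := D.exists_mem_factorO i a
      exact ⟨⟨g, hg⟩, LinearEquiv.ext fun x => Subtype.ext (hga x)⟩

theorem factorOEquiv_apply (i : Fin D.r) (g : D.factorO (some i)) (x : D.ℓ i) :
    (D.factorOEquiv i g x : V) = ((g : q.O) : V ≃ₗ[F] V) x :=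
  rfl

/-- Outside characteristic `2`, a homomorphism from the factor `GL(ℓᵢ)` to a commutative group is
trivial as soon as it is trivial on the diagonal torus. -/
theorem eq_one_of_forall_diagonalTorus {A : Type*} [CommGroup A] (h2 : (2 : F) ≠ 0) (i : Fin D.r)
    {n : ℕ} (b : Module.Basis (Fin n) F (D.ℓ i)) (χ : D.factorO (some i) →* A)
    (hχ : ∀ t (ht : t ∈ D.diagonalTorus i b), χ ⟨t, ht.1⟩ = 1) (g : D.factorO (some i)) :
    χ g = 1 := by
  rw [← (D.factorOEquiv i).symm_apply_apply g]
  refine LinearEquiv.eq_one_of_forall_diagonal h2 b (χ.comp (D.factorOEquiv i).symm.toMonoidHom)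
    (fun a ha => ?_) (D.factorOEquiv i g)
  refine hχ _ ⟨((D.factorOEquiv i).symm a).2, fun k => ?_⟩
  obtain ⟨c, hc⟩ := ha k
  refine ⟨c, ?_⟩
  rw [← D.factorOEquiv_apply, MulEquiv.apply_symm_apply, hc, Submodule.coe_smul]

/-! ### Decomposed Levi covers -/

section

variable [TopologicalSpace F] [IsTopologicalRing F]
  {A : Type*} [CommGroup A] [TopologicalSpace A] [Finite A] [DiscreteTopology A]

theorem isDecomposedO_iff (E : TopCExt A q.O) :
    D.IsDecomposedO E ↔ Pairwise fun o o' => ∀ x y : E.carrier,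
      x ∈ (D.factorO o).comap E.proj → y ∈ (D.factorO o').comap E.proj → Commute x y :=
  E.nonempty_iso_externalBaerSum_iff (D.pairwise_commute _ fun _ => le_rfl) D.prodEquivLeviO
    fun _ => rfl

theorem isDecomposedSO_iff (E : TopCExt A q.O) :
    D.IsDecomposedSO E ↔ Pairwise fun o o' => ∀ x y : E.carrier,
      x ∈ (D.factorSO o).comap E.proj → y ∈ (D.factorSO o').comap E.proj → Commute x y :=
  E.nonempty_iso_externalBaerSum_iff (D.pairwise_commute _ D.factorSO_le) D.prodEquivLeviSO
    fun _ => rfl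

/-- If the preimage of `M(F)` is decomposed, then the preimages of `GL(ℓᵢ)` and `O(V♭)(F)` commute
as soon as the diagonal torus of `GL(ℓᵢ)` has trivial commutators with one element `τ` of `O(V♭)(F)`
outside `SO(V♭)(F)`. -/
theorem commute_of_isDecomposedSO (h2 : (2 : F) ≠ 0) {E : TopCExt A q.O}
    (hE : D.IsDecomposedSO E) {τ : q.O} (hτ : τ ∈ D.factorO none) (hτ' : τ ∉ q.SO) {i : Fin D.r}
    {n : ℕ} (b : Module.Basis (Fin n) F (D.ℓ i))
    (hb : ∀ t, ∀ ht : t ∈ D.diagonalTorus i b,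
      E.comm t τ (D.commute_of_mem (Option.some_ne_none i) t τ ht.1 hτ) = 1)
    {x y : E.carrier} (hx : E.proj x ∈ D.factorO (some i)) (hy : E.proj y ∈ D.factorO none) :
    Commute x y := by
  have hSO : ∀ z : E.carrier, E.proj z ∈ D.factorSO none → Commute x z := fun z hz =>
    (D.isDecomposedSO_iff E).1 hE (Option.some_ne_none i) x z hx hz
  -- Either `y` or its translate by a preimage `z` of `τ` lies over `SO(V♭)(F)`.
  by_cases hyS : E.proj y ∈ q.SO
  · exact hSO y ⟨hy, hyS⟩
  obtain ⟨z, hz⟩ := E.isSES.isOpenQuotientMap.surjective τ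
  have hxz : Commute x z := (E.commute_iff_comm_eq_one
    (D.commute_of_mem (Option.some_ne_none i) _ τ hx hτ) rfl hz).2 <|
    D.eq_one_of_forall_diagonalTorus h2 i b
      (E.commHom (D.factorO (some i)) τ fun k hk =>
        D.commute_of_mem (Option.some_ne_none i) k τ hk hτ) hb ⟨E.proj x, hx⟩
  have hzy : Commute x (z⁻¹ * y) := hSO _ <| by
    rw [map_mul, map_inv, hz]
    exact ⟨(D.factorO none).mul_mem ((D.factorO none).inv_mem hτ) hy, inv_mul_mem_SO hτ' hyS⟩
  simpa using hxz.mul_right hzy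

end

end LeviDatum

end QuadSpace

theorem mainTheorem8 {F : Type*} [Field F] [TopologicalSpace F] [IsTopologicalDivisionRing F]
    [LocallyCompactSpace F] [T2Space F] (hF : ¬ DiscreteTopology F) (hchar : (2 : F) ≠ 0)
    {V : Type*} [AddCommGroup V] [Module F V] [FiniteDimensional F V] (q : QuadSpace F V)
    (m : ℕ) [NeZero m] (E : TopCExt (rootsOfUnity m ℂ) q.O)
    (D : q.LeviDatum) (b : ∀ i, Module.Basis (Fin (Module.finrank F (D.ℓ i))) F (D.ℓ i))
    (τ : q.O) (hτ : τ ∈ D.factorO none) (hτ' : τ ∉ q.SO) :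
    D.IsDecomposedO E ↔
      D.IsDecomposedSO E ∧
        ∀ i, ∀ t, ∀ ht : t ∈ D.diagonalTorus i (b i),
          E.comm t τ (D.commute_of_mem (Option.some_ne_none i) t τ ht.1 hτ) = 1 := by
  constructor
  · intro h
    rw [D.isDecomposedO_iff] at h
    refine ⟨(D.isDecomposedSO_iff E).2 fun o o' ho x y hx hy =>
      h ho x y (D.factorSO_le o hx) (D.factorSO_le o' hy), fun i t ht => ?_⟩
    obtain ⟨x, hx⟩ := E.isSES.isOpenQuotientMap.surjective t
    obtain ⟨y, hy⟩ := E.isSES.isOpenQuotientMap.surjective τ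
    refine (E.commute_iff_comm_eq_one _ hx hy).1 (h (Option.some_ne_none i) x y ?_ ?_)
    · rw [Subgroup.mem_comap, hx]
      exact ht.1
    · rwa [Subgroup.mem_comap, hy]
  · rintro ⟨h, hb⟩
    refine (D.isDecomposedO_iff E).2 ?_
    rintro (_ | i) (_ | j) ho x y hx hy
    · exact absurd rfl ho
    · exact (D.commute_of_isDecomposedSO hchar h hτ hτ' (b j) (hb j) hy hx).symm
    · exact D.commute_of_isDecomposedSO hchar h hτ hτ' (b i) (hb i) hx hy
    · exact (D.isDecomposedSO_iff E).1 h ho x y hx hy
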